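/- **Setting.** A network is a directed multigraph with $m$ links. Time is discrete. Packets are injected over time, each with a route $e_0,e_1,\dots,e_d$, which is a directed path that uses no link twice. In each time step each link forwards at most one packet. Let $w\ge 1$ be an integer, $0\le r<1$ and $\varepsilon=1-r$. The injections are $(w,r)$-admissible if, for every $L\ge w$, every time interval of length $L$ and every link $e$, at most $rL$ packets whose routes contain $e$ are injected during the interval. Let $d_{\max}\le m$ be an integer such that every route has at most $d_{\max}$ links (for example the length of the longest simple path of the network). **Parameters.** For an integer $M$ put $T=\left\lceil \frac{36m}{\varepsilon^3}\ln(2Mm^2)\right\rceil$. Call $M$ a valid interval length if $$M\ge\max\left\{\frac{1-\varepsilon/2}{\varepsilon/6}(d_{\max}+1)T,\; w\right\}.$$ **Protocol.** Fix a linear order on packets. The packets injected during $[(\gamma-1)M,\gamma M)$, $\gamma\ge1$, are held at their initial links until time $\gamma M$. At that time each packet $p$ receives an initial deadline $\tau_0^p$ in $[\gamma M+T,(\gamma+1)M-d_{\max}T)$, and its deadline at the $k$-th link of its route is $\tau_k^p=\tau_0^p+kT$. From then on, each link in each step forwards, among the packets waiting for it, the one with the earliest deadline for this link (ties are broken by the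 order on packets). The initial deadlines are chosen independently at each initial link $e_0$, by the method of conditional expectations. Let $S$ be the set of packets of the batch with initial link $e_0$, let $S_e\subseteq S$ be those whose routes contain $e$, let $X^{p,e}_t\in\{0,1\}$ indicate that $p$ has a deadline for link $e$ in $[t,t+T)$, and let $$\beta_e=\frac{M}{M-(d_{\max}+1)T}\max\left\{\frac{|S_e|}{M},\frac{\varepsilon}{3m}\right\}.$$ The packets $p_0,p_1,\dots$ of $S$ are processed in order, and $p_i$ receives the (smallest) initial deadline $\delta_i$ that minimizes $$h(\delta_0,\dots,\delta_i)=\sum_{e}\ \sum_{t=\gamma M}^{(\gamma+1)M-T-1}\frac{\prod_{p\in S_e}E\left[(1+\varepsilon/2)^{X^{p,e}_t}\,\middle|\,\tau_0^{p_0}=\delta_0,\dots,\tau_0^{p_i}=\delta_i\right]}{(1+\varepsilon/2)^{(1+\varepsilon/2)\beta_eT}},$$ where the expectation is over independent initial deadlines uniform on the integers of $[\gamma M+T,(\gamma+1)M-d_{\max}T)$. The protocol is deterministic and distributed: an initial link chooses deadlines as a function only of the packets of the batch injected at this link (and of the fixed parameters), and a link chooses the packet to forward as a function only of the packets waiting at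 it and the initial deadlines carried in their headers. **Theorem.** There is a polynomial $P$ in three variables, independent of all the data, such that for all networks and parameters as above: 1. there is a valid interval length $M$ with $2M\le P(m,w,1/\varepsilon)$; and 2. for every valid interval length $M$ and all $(w,r)$-admissible injections with routes of at most $d_{\max}$ links, the protocol delivers every packet to its destination within $2M$ steps of its injection. -/

import Mathlib

open scoped BigOperators

namespace PacketScheduling

/-- A network: a directed multigraph with node set `V` and link set `E`. -/
structure Network (V E : Type*) where
  /-- the node at which a link starts -/
  src : E → V
  /-- the node at which a link ends -/
  tgt : E → V

/-- `l = [e₀, …, e_d]` is a route of the network: a nonempty directed path using no link twice. -/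
def Network.IsRoute {V E : Type*} (G : Network V E) (l : List E) : Prop :=
  l ≠ [] ∧ l.IsChain (fun e f => G.tgt e = G.src f) ∧ l.Nodup

/-- A (unit size) packet: its injection time, its route, and a serial number that distinguishes
packets injected at the same time with the same route. -/
structure Packet (E : Type*) where
  time : ℕ
  route : List E
  id : ℕ

/-- A sequence of injections: `A.pkts t` is the finite set of packets injected at time `t`. -/
structure Injection {V E : Type*} (G : Network V E) where
  pkts : ℕ → Finset (Packet E)
  time_eq : ∀ t, ∀ p ∈ pkts t, p.time = t
  isRoute : ∀ t, ∀ p ∈ pkts t, G.IsRoute p.route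

/-- `(w, r)`-admissibility: in every time interval `[s, s + L)` of length `L ≥ w`, at most `r * L`
packets whose route passes through a given link `e` are injected. -/
def Injection.Admissible {V E : Type*} [DecidableEq E] {G : Network V E}
    (A : Injection G) (w : ℕ) (r : ℝ) : Prop :=
  ∀ s L : ℕ, w ≤ L → ∀ e : E,
    ∑ t ∈ Finset.Ico s (s + L), (((A.pkts t).filter (fun p => e ∈ p.route)).card : ℝ) ≤ r * L

section Protocols

variable {V E : Type*} [DecidableEq E] [LinearOrder (Packet E)]

/-- The packets with initial link `e₀` injected during `[(γ - 1) M, γ M)`. -/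
def Injection.batch {G : Network V E} (A : Injection G) (M γ : ℕ) (e₀ : E) :
    Finset (Packet E) :=
  ((Finset.Ico ((γ - 1) * M) (γ * M)).biUnion A.pkts).filter (fun p => p.route.head? = some e₀)

/-- A deterministic, distributed scheduling protocol that works in batches.  Time is split into
intervals of length `interval`; packets are held back at their initial link until the interval of
their injection is over.  All decisions are deterministic functions of local information:
* `header e₀ γ S p` is the number written into the header of packet `p` by its initial link `e₀`
  at time `γ * interval`; it is a function of the set `S` of packets that were injected during
  `[(γ - 1) * interval, γ * interval)` with the same initial link `e₀`;
* `serve e t Q` is the packet (if any) that link `e` forwards in step `t`; it is a function of the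
  packets waiting at `e`, together with their headers.  A link forwards at most one packet per
  step. -/
structure DistributedProtocol (E : Type*) where
  interval : ℕ
  header : E → ℕ → Finset (Packet E) → Packet E → ℕ
  serve : E → ℕ → Finset (Packet E × ℕ) → Option (Packet E × ℕ)
  serve_mem : ∀ e t Q x, serve e t Q = some x → x ∈ Q

namespace DistributedProtocol

variable (P : DistributedProtocol E) {G : Network V E} (A : Injection G)

/-- The index `γ` with `p.time ∈ [(γ - 1) * interval, γ * interval)`. -/
def batchIndex (p : Packet E) : ℕ := p.time / P.interval + 1

/-- The header that packet `p` receives from its initial link. -/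
def stamp (p : Packet E) : ℕ :=
  match p.route.head? with
  | some e₀ => P.header e₀ (P.batchIndex p) (A.batch P.interval (P.batchIndex p) e₀) p
  | none => 0

/-- The packets waiting at link `e` at the beginning of step `t`, with their headers, when `c p` is
the number of links that `p` has crossed so far: those that have been released (their batch is
complete) and whose next link is `e`. -/
def queue (c : Packet E → ℕ) (t : ℕ) (e : E) : Finset (Packet E × ℕ) :=
  (((Finset.range t).biUnion A.pkts).filter
    (fun p => P.batchIndex p * P.interval ≤ t ∧ p.route[c p]? = some e)).image
      (fun p => (p, P.stamp A p))

open Classical in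
/-- `P.crossed A t p` is the number of links that `p` has crossed at time `t`, that is, after the
steps `0, …, t - 1`. -/
noncomputable def crossed : ℕ → Packet E → ℕ
  | 0 => fun _ => 0
  | t + 1 => fun p =>
      if ∃ e, P.serve e t (P.queue A (crossed t) t e) = some (p, P.stamp A p) then
        crossed t p + 1
      else crossed t p

/-- Packet `p` has crossed all links of its route, i.e. is at its destination, at time `t`. -/
def DeliveredBy (t : ℕ) (p : Packet E) : Prop := P.crossed A t p = p.route.length

end DistributedProtocol

/-! ### The derandomized protocol -/

/-- The spacing `T = (36 m / ε³) log (2 M m²)` of the deadlines, rounded up to an integer. -/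
noncomputable def spacing (m : ℕ) (ε : ℝ) (M : ℕ) : ℕ :=
  ⌈36 * m / ε ^ 3 * Real.log (2 * M * m ^ 2)⌉₊

/-- The requirement on the interval length:
`M ≥ max { (1 - ε/2)/(ε/6) * (dmax + 1) * T, w }`. -/
def IsIntervalLength (m w : ℕ) (ε : ℝ) (dmax M : ℕ) : Prop :=
  (1 - ε / 2) / (ε / 6) * (dmax + 1) * spacing m ε M ≤ M ∧ w ≤ M

/-- The possible initial deadlines `[γ M + T, (γ + 1) M - dmax T)` for the `γ`-th batch. -/
def initialWindow (dmax M T γ : ℕ) : Finset ℕ :=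
  Finset.Ico (γ * M + T) ((γ + 1) * M - dmax * T)

open Classical in
/-- The indicator `X^{p,e}_{[t,t+T)}` when `p` has initial deadline `δ`, so that its deadline for
the `k`-th link of its route is `δ + k T`: it is `1` if `e` is the `k`-th link of `p`, for some `k`,
and the deadline of `p` for it lies in `[t, t + T)`. -/
noncomputable def indicatorX (T : ℕ) (p : Packet E) (e : E) (t δ : ℕ) : ℕ :=
  if ∃ k : ℕ, p.route[k]? = some e ∧ t ≤ δ + k * T ∧ δ + k * T < t + T then 1 else 0

/-- The conditional expectation of `(1 + ε/2) ^ X^{p,e}_{[t,t+T)}` for an initial deadline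
of `p` that is uniform on `W`, given that it equals `δ` (`some δ`) or given nothing (`none`). -/
noncomputable def condMoment (ε : ℝ) (T : ℕ) (W : Finset ℕ) (p : Packet E) (e : E) (t : ℕ) :
    Option ℕ → ℝ
  | some δ => (1 + ε / 2) ^ indicatorX T p e t δ
  | none => 𝔼 δ ∈ W, (1 + ε / 2) ^ indicatorX T p e t δ

/-- `β_{e₀,e} = M / (M - (dmax + 1) T) * max {|S_{e₀,e}| / M, ε / (3 m)}`, where `S` is the batch at
`e₀` and `S_{e₀,e}` its subset of packets whose route contains `e`. -/
noncomputable def beta (m : ℕ) (ε : ℝ) (dmax M T : ℕ) (S : Finset (Packet E)) (e : E) : ℝ :=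
  (M : ℝ) / (M - (dmax + 1) * T) *
    max (((S.filter (fun p => e ∈ p.route)).card : ℝ) / M) (ε / (3 * m))

/-- The conditional expectation bound `h`, given the partial assignment `σ` of initial deadlines to
packets of the batch `S`, the other initial deadlines being independent and uniform:
`∑_{e,t} E[∏_p (1 + ε/2) ^ X^{p,e}_{[t,t+T)} | σ] / (1 + ε/2) ^ ((1 + ε/2) β_{e₀,e} T)`,
where `p` ranges over `S_{e₀,e}` and `t` over `[γ M, (γ + 1) M - T)`. -/
noncomputable def estimator [Fintype E] (ε : ℝ) (dmax M T γ : ℕ) (S : Finset (Packet E))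
    (σ : Packet E → Option ℕ) : ℝ :=
  ∑ e : E, ∑ t ∈ Finset.Ico (γ * M) ((γ + 1) * M - T),
    (∏ p ∈ S.filter (fun p => e ∈ p.route),
        condMoment ε T (initialWindow dmax M T γ) p e t (σ p)) /
      (1 + ε / 2) ^ ((1 + ε / 2) * beta (Fintype.card E) ε dmax M T S e * T)

/-- The initial deadline for the next packet `p`: the (least) `δ` in the window which minimizes the
conditional expectation bound, given the initial deadlines `σ` chosen so far. -/
noncomputable def bestDeadline [Fintype E] (ε : ℝ) (dmax M T γ : ℕ) (S : Finset (Packet E))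
    (σ : Packet E → Option ℕ) (p : Packet E) : ℕ :=
  sInf {δ | δ ∈ initialWindow dmax M T γ ∧ ∀ δ' ∈ initialWindow dmax M T γ,
    estimator ε dmax M T γ S (Function.update σ p (some δ)) ≤
      estimator ε dmax M T γ S (Function.update σ p (some δ'))}

/-- The method of conditional expectations for the batch `S`: go through the packets of `S` one
after the other and fix their initial deadlines by `bestDeadline`. -/
noncomputable def condExpAssignment [Fintype E] (ε : ℝ) (dmax M T γ : ℕ)
    (S : Finset (Packet E)) : Packet E → Option ℕ :=
  (S.sort (· ≤ ·)).foldl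
    (fun σ p => Function.update σ p (some (bestDeadline ε dmax M T γ S σ p))) (fun _ => none)

/-- Priority at link `e` of a packet with initial deadline `δ`: first its deadline `δ + k T` for
`e`, where `e` is the `k`-th link of its route; ties are broken by the order on packets. -/
def priority (T : ℕ) (e : E) (x : Packet E × ℕ) : ℕ ×ₗ Packet E :=
  toLex (x.2 + x.1.route.idxOf e * T, x.1)

/-- The derandomized protocol: intervals of length `M`, initial deadlines (carried in the headers)
chosen at each initial link by the method of conditional expectations, deadlines spaced `T` apart
along the route, and earliest deadline first at each link. -/
noncomputable def derandomized (E : Type*) [Fintype E] [DecidableEq E] [LinearOrder (Packet E)]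
    (ε : ℝ) (dmax M : ℕ) : DistributedProtocol E where
  interval := M
  header := fun _ γ S p =>
    (condExpAssignment ε dmax M (spacing (Fintype.card E) ε M) γ S p).getD 0
  serve := fun e _ Q => Q.toList.argmin (priority (spacing (Fintype.card E) ε M) e)
  serve_mem := fun _ _ _ _ h => Finset.mem_toList.mp (List.argmin_mem h)

end Protocols

end PacketScheduling

open PacketScheduling

/-! Suppose every packet is released at least `T` steps before its first deadline, and any `T`
consecutive steps contain at most `T` deadlines for each link. Then earliest deadline first meets
all deadlines (`lt_crossed_of_load_le`): a packet late at `e` would have waited there for `T` steps,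
each spent on another packet whose deadline falls in the same window, giving `T + 1` deadlines.

The load condition comes from a Chernoff bound. With uniform initial deadlines, one initial link
places on average at most `β T` deadlines for `e` in a window. The estimator, which sums exponential
moment bounds over links and windows, starts below one (`estimator_none_lt_one`), and the greedy
choices never increase it. Once all deadlines are fixed, every term is below one, so no window holds
more than `(1 + ε/2) β T` of them. The rates `β` of all initial links sum to at most `1 - ε/2`
(`sum_beta_le`), and `(1 + ε/2)(1 - ε/2) ≤ 1`. Deadlines of different batches are too far apart to
share a window (`card_deadlines_le`).

A valid `M` of polynomial size exists because `T` grows only logarithmically with `M`. -/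

namespace PacketScheduling

/-! ### Exponential moments of random initial deadlines -/

section Estimator

variable {E : Type*} {ε : ℝ} {T : ℕ} {W : Finset ℕ}

theorem indicatorX_eq_zero_or_one (T : ℕ) (p : Packet E) (e : E) (t δ : ℕ) :
    indicatorX T p e t δ = 0 ∨ indicatorX T p e t δ = 1 := by
  unfold indicatorX
  split <;> simp

theorem condMoment_nonneg (hε : 0 ≤ ε) (p : Packet E) (e : E) (t : ℕ) (o : Option ℕ) :
    0 ≤ condMoment ε T W p e t o := by
  cases o with
  | some δ => exact pow_nonneg (by linarith) _
  | none => exact Finset.expect_nonneg fun δ _ => pow_nonneg (by linarith) _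

/-- A packet with a simple route has, over all initial deadlines, at most `T` ways of placing a
deadline for `e` in a window of length `T`. -/
theorem sum_indicatorX_le (p : Packet E) (hp : p.route.Nodup) (e : E) (t : ℕ) :
    ∑ δ ∈ W, indicatorX T p e t δ ≤ T := by
  classical
  by_cases he : e ∈ p.route
  · set k := p.route.idxOf e
    -- On a simple route `e` has a single position `k`, so the good `δ` form one interval; truncated
    -- subtraction can only shorten it.
    have hsub : ∀ δ, indicatorX T p e t δ ≤
        if δ ∈ Finset.Ico (t - k * T) (t + T - k * T) then 1 else 0 := by
      intro δ
      unfold indicatorX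
      split_ifs with h h'
      · exact le_rfl
      · obtain ⟨j, hj, h1, h2⟩ := h
        obtain ⟨hlt, rfl⟩ := List.getElem?_eq_some_iff.mp hj
        have hjk : k = j := hp.idxOf_getElem j hlt
        rw [hjk, Finset.mem_Ico] at h'
        omega
      · exact Nat.zero_le _
      · exact le_rfl
    calc ∑ δ ∈ W, indicatorX T p e t δ
        ≤ ∑ δ ∈ W, if δ ∈ Finset.Ico (t - k * T) (t + T - k * T) then 1 else 0 :=
          Finset.sum_le_sum fun δ _ => hsub δ
      _ = (W.filter (· ∈ Finset.Ico (t - k * T) (t + T - k * T))).card := by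
          rw [Finset.sum_boole, Nat.cast_id]
      _ ≤ (Finset.Ico (t - k * T) (t + T - k * T)).card :=
          Finset.card_le_card fun x hx => (Finset.mem_filter.mp hx).2
      _ ≤ T := by rw [Nat.card_Ico]; omega
  · refine (Finset.sum_eq_zero fun δ _ => ?_).trans_le (Nat.zero_le T)
    unfold indicatorX
    exact if_neg fun ⟨k, hk, _⟩ => he (List.mem_of_getElem? hk)

/-- As `X` is 0 or 1, the moment is linear in `X`; the probability of `X = 1` is at most `T / |W|`,
and `1 + x ≤ exp x`. -/
theorem condMoment_none_le (hε : 0 ≤ ε) (hW : W.Nonempty) (p : Packet E) (hp : p.route.Nodup)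
    (e : E) (t : ℕ) :
    condMoment ε T W p e t none ≤ Real.exp (ε / 2 * (T / W.card)) := by
  have hc : (0 : ℝ) < W.card := by exact_mod_cast hW.card_pos
  have hpow : ∀ δ, (1 + ε / 2) ^ indicatorX T p e t δ = 1 + ε / 2 * indicatorX T p e t δ := by
    intro δ
    rcases indicatorX_eq_zero_or_one T p e t δ with h | h <;> simp [h]
  have hsum : ((∑ δ ∈ W, indicatorX T p e t δ : ℕ) : ℝ) ≤ T := by
    exact_mod_cast sum_indicatorX_le p hp e t
  push_cast at hsum
  have : condMoment ε T W p e t none ≤ ε / 2 * (T / W.card) + 1 := by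
    simp only [condMoment, hpow]
    rw [Finset.expect_eq_sum_div_card, Finset.sum_add_distrib, ← Finset.mul_sum, Finset.sum_const,
      nsmul_one, add_div, div_self hc.ne', add_comm, mul_div_assoc]
    gcongr
  exact this.trans (Real.add_one_le_exp _)

variable [DecidableEq E] [Fintype E] {dmax M γ : ℕ} {S : Finset (Packet E)}

/-- The Chernoff exponent: `(1 + η) log (1 + η) ≥ η + η² / 3` for `η ≤ 1`. -/
theorem add_sq_div_three_le_mul_log {η : ℝ} (h0 : 0 ≤ η) (h1 : η ≤ 1) :
    η + η ^ 2 / 3 ≤ (1 + η) * Real.log (1 + η) := by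
  -- From `log (1 + η) ≥ 2η / (η + 2)`; after clearing denominators the slack is `η² (1 - η) / 3`.
  have h := mul_le_mul_of_nonneg_left (Real.le_log_one_add_of_nonneg h0)
    (by linarith : (0 : ℝ) ≤ 1 + η)
  refine le_trans ?_ h
  rw [← mul_div_assoc, le_div_iff₀ (by linarith)]
  nlinarith [mul_nonneg (sq_nonneg η) (sub_nonneg.mpr h1)]

theorem IsIntervalLength.mul_le {m w : ℕ} (hε : 0 < ε) (h : IsIntervalLength m w ε dmax M) :
    (dmax + 1) * (spacing m ε M : ℝ) * (6 - 3 * ε) ≤ ε * M := by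
  have := h.1
  rw [div_mul_eq_mul_div, div_mul_eq_mul_div, div_le_iff₀ (by positivity)] at this
  linarith

theorem IsIntervalLength.mul_lt {m w : ℕ} (hε : 0 < ε) (hε1 : ε ≤ 1) (hw : 1 ≤ w)
    (h : IsIntervalLength m w ε dmax M) :
    (dmax + 1) * spacing m ε M < M := by
  have h1 := h.mul_le hε
  have hM : (1 : ℝ) ≤ M := by exact_mod_cast hw.trans h.2
  have hT : (0 : ℝ) ≤ (dmax + 1) * (spacing m ε M : ℝ) := by positivity
  have : (dmax + 1) * (spacing m ε M : ℝ) < M := by nlinarith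
  exact_mod_cast this

theorem card_initialWindow (h : (dmax + 1) * T ≤ M) :
    ((initialWindow dmax M T γ).card : ℝ) = M - (dmax + 1) * T := by
  have : (initialWindow dmax M T γ).card + (dmax + 1) * T = M := by
    rw [initialWindow, Nat.card_Ico]
    have h1 : (dmax + 1) * T = dmax * T + T := by ring
    have h2 : (γ + 1) * M = γ * M + M := by ring
    omega
  rw [eq_sub_iff_add_eq]
  exact_mod_cast this

theorem initialWindow_nonempty (h : (dmax + 1) * T < M) :
    (initialWindow dmax M T γ).Nonempty := by
  rw [initialWindow, Finset.nonempty_Ico]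
  have h1 : (dmax + 1) * T = dmax * T + T := by ring
  have h2 : (γ + 1) * M = γ * M + M := by ring
  omega

theorem spacing_pos {m : ℕ} (hm : 0 < m) (hε : 0 < ε) (hM : 0 < M) : 0 < spacing m ε M := by
  rw [spacing, Nat.ceil_pos]
  have h1 : (1 : ℝ) ≤ m := by exact_mod_cast hm
  have h2 : (1 : ℝ) ≤ M := by exact_mod_cast hM
  have : 0 < Real.log (2 * M * m ^ 2) := by
    apply Real.log_pos
    nlinarith [mul_le_mul h2 (one_le_pow₀ h1 (n := 2)) zero_le_one (by linarith)]
  positivity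

/-- Before any deadline is chosen, the estimator is less than one. -/
theorem estimator_none_lt_one [Nonempty E] {w : ℕ} (hε : 0 < ε) (hε1 : ε ≤ 1) (hw : 1 ≤ w)
    (hM : IsIntervalLength (Fintype.card E) w ε dmax M) (hS : ∀ p ∈ S, p.route.Nodup) :
    estimator ε dmax M (spacing (Fintype.card E) ε M) γ S (fun _ => none) < 1 := by
  set m := Fintype.card E
  set T := spacing m ε M
  have hm : 0 < m := Fintype.card_pos
  have hm1 : (1 : ℝ) ≤ m := by exact_mod_cast hm
  have hM1 : (1 : ℝ) ≤ M := by exact_mod_cast hw.trans hM.2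
  have hlt := hM.mul_lt hε hε1 hw
  have hlt' : ((dmax : ℝ) + 1) * T < M := by exact_mod_cast hlt
  have hW : (initialWindow dmax M T γ).Nonempty := initialWindow_nonempty hlt
  have hD : 0 < (M : ℝ) - (dmax + 1) * T := by linarith
  have hT : 36 * m / ε ^ 3 * Real.log (2 * M * m ^ 2) ≤ T := Nat.le_ceil _
  have hterm : ∀ e : E, ∀ t, (∏ p ∈ S.filter (fun p => e ∈ p.route),
        condMoment ε T (initialWindow dmax M T γ) p e t none) /
      (1 + ε / 2) ^ ((1 + ε / 2) * beta m ε dmax M T S e * T) ≤ (2 * M * m ^ 2 : ℝ)⁻¹ := by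
    intro e t
    set n := (S.filter (fun p => e ∈ p.route)).card
    set β := beta m ε dmax M T S e with hβ
    have hβ1 : (n : ℝ) * (T / (M - (dmax + 1) * T)) ≤ β * T := by
      have : (n : ℝ) / M * (M / (M - (dmax + 1) * T)) ≤ β := by
        rw [hβ, beta, mul_comm]
        exact mul_le_mul_of_nonneg_left (le_max_left _ _) (by positivity)
      calc (n : ℝ) * (T / (M - (dmax + 1) * T))
          = (n : ℝ) / M * (M / (M - (dmax + 1) * T)) * T := by field_simp
        _ ≤ _ := by gcongr
    have hβ2 : ε / (3 * m) ≤ β := by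
      have h1 : 1 ≤ (M : ℝ) / (M - (dmax + 1) * T) := by
        rw [one_le_div hD]
        have : 0 ≤ ((dmax : ℝ) + 1) * T := by positivity
        linarith
      have h2 : ε / (3 * m) ≤ max ((n : ℝ) / M) (ε / (3 * m)) := le_max_right _ _
      have h3 : 0 ≤ ε / (3 * m) := by positivity
      rw [hβ, beta]
      nlinarith
    -- The constant 36 in `T` is chosen for this: the floor `ε / (3m)` of `β` times the Chernoff
    -- exponent `ε² / 12` is `ε³ / (36m)`.
    have hβT : Real.log (2 * M * m ^ 2) ≤ (ε / 2) ^ 2 / 3 * (β * T) := by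
      calc Real.log (2 * M * m ^ 2)
          = (ε / 2) ^ 2 / 3 * (ε / (3 * m) * (36 * m / ε ^ 3 * Real.log (2 * M * m ^ 2))) := by
            field_simp; ring
        _ ≤ (ε / 2) ^ 2 / 3 * (ε / (3 * m) * T) := by gcongr
        _ ≤ _ := by gcongr
    have hprod : ∏ p ∈ S.filter (fun p => e ∈ p.route),
        condMoment ε T (initialWindow dmax M T γ) p e t none ≤ Real.exp (ε / 2 * (β * T)) := by
      calc _ ≤ ∏ p ∈ S.filter (fun p => e ∈ p.route),
            Real.exp (ε / 2 * (T / (initialWindow dmax M T γ).card)) :=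
            Finset.prod_le_prod (fun p _ => condMoment_nonneg hε.le _ _ _ _) fun p hp =>
              condMoment_none_le hε.le hW p (hS p (Finset.mem_filter.mp hp).1) e t
        _ = Real.exp (ε / 2 * (n * (T / (M - (dmax + 1) * T)))) := by
            rw [Finset.prod_const, ← Real.exp_nat_mul, card_initialWindow hlt.le]
            congr 1
            ring
        _ ≤ _ := by gcongr
    have hlog := add_sq_div_three_le_mul_log (η := ε / 2) (by linarith) (by linarith)
    have hβT0 : 0 ≤ β * T := by
      have : 0 ≤ ε / (3 * m) := by positivity
      exact mul_nonneg (this.trans hβ2) (Nat.cast_nonneg T)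
    rw [Real.rpow_def_of_pos (by linarith)]
    have hpos : (0 : ℝ) < 2 * M * m ^ 2 := by positivity
    rw [← Real.exp_log hpos, ← Real.exp_neg]
    refine (div_le_div_of_nonneg_right hprod (Real.exp_pos _).le).trans ?_
    rw [← Real.exp_sub, Real.exp_le_exp]
    nlinarith [mul_le_mul_of_nonneg_right hlog hβT0]
  calc estimator ε dmax M T γ S (fun _ => none)
      ≤ ∑ e : E, ∑ t ∈ Finset.Ico (γ * M) ((γ + 1) * M - T), (2 * M * m ^ 2 : ℝ)⁻¹ :=
        Finset.sum_le_sum fun e _ => Finset.sum_le_sum fun t _ => hterm e t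
    _ = m * ((Finset.Ico (γ * M) ((γ + 1) * M - T)).card * (2 * M * m ^ 2 : ℝ)⁻¹) := by
        rw [Finset.sum_const, Finset.sum_const, nsmul_eq_mul, nsmul_eq_mul, Finset.card_univ]
    _ ≤ m * (M * (2 * M * m ^ 2 : ℝ)⁻¹) := by
        gcongr
        rw [Nat.card_Ico, add_mul]
        omega
    _ = (2 * m : ℝ)⁻¹ := by field_simp
    _ < 1 := by
        apply inv_lt_one_of_one_lt₀
        linarith

/-! ### The method of conditional expectations -/

variable [LinearOrder (Packet E)]

/-- Averaging the estimator over the initial deadline of an undecided packet does not change it. -/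
theorem expect_estimator_update (hW : (initialWindow dmax M T γ).Nonempty)
    {σ : Packet E → Option ℕ} {p : Packet E} (hσ : σ p = none) :
    𝔼 δ ∈ initialWindow dmax M T γ,
      estimator ε dmax M T γ S (Function.update σ p (some δ)) = estimator ε dmax M T γ S σ := by
  unfold estimator
  rw [Finset.expect_sum_comm]
  refine Finset.sum_congr rfl fun e _ => ?_
  rw [Finset.expect_sum_comm]
  refine Finset.sum_congr rfl fun t _ => ?_
  rw [← Finset.expect_div]
  congr 1
  -- At most one factor of the product depends on `δ`, and its average is by definition the
  -- undecided moment.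
  by_cases hp : p ∈ S.filter (fun p => e ∈ p.route)
  · have herase : ∀ δ, ∏ q ∈ (S.filter (fun p => e ∈ p.route)).erase p,
        condMoment ε T (initialWindow dmax M T γ) q e t (Function.update σ p (some δ) q) =
        ∏ q ∈ (S.filter (fun p => e ∈ p.route)).erase p,
        condMoment ε T (initialWindow dmax M T γ) q e t (σ q) := fun δ =>
      Finset.prod_congr rfl fun q hq => by
        rw [Function.update_of_ne (Finset.ne_of_mem_erase hq)]
    simp_rw [← Finset.mul_prod_erase _ _ hp, herase, Function.update_self]
    rw [← Finset.expect_mul, hσ]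
    rfl
  · have hcongr : ∀ δ, ∏ q ∈ S.filter (fun p => e ∈ p.route),
        condMoment ε T (initialWindow dmax M T γ) q e t (Function.update σ p (some δ) q) =
        ∏ q ∈ S.filter (fun p => e ∈ p.route),
        condMoment ε T (initialWindow dmax M T γ) q e t (σ q) := fun δ =>
      Finset.prod_congr rfl fun q hq => by
        rw [Function.update_of_ne (ne_of_mem_of_not_mem hq hp)]
    simp_rw [hcongr]
    exact Finset.expect_const hW _

theorem bestDeadline_spec (hW : (initialWindow dmax M T γ).Nonempty)
    (σ : Packet E → Option ℕ) (p : Packet E) :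
    bestDeadline ε dmax M T γ S σ p ∈ initialWindow dmax M T γ ∧
      ∀ δ' ∈ initialWindow dmax M T γ,
        estimator ε dmax M T γ S
            (Function.update σ p (some (bestDeadline ε dmax M T γ S σ p))) ≤
          estimator ε dmax M T γ S (Function.update σ p (some δ')) := by
  obtain ⟨δ, hδ, hmin⟩ := Finset.exists_min_image _
    (fun δ => estimator ε dmax M T γ S (Function.update σ p (some δ))) hW
  exact Nat.sInf_mem (s := {δ | δ ∈ initialWindow dmax M T γ ∧ ∀ δ' ∈ initialWindow dmax M T γ,
    estimator ε dmax M T γ S (Function.update σ p (some δ)) ≤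
      estimator ε dmax M T γ S (Function.update σ p (some δ'))}) ⟨δ, hδ, hmin⟩

/-- A minimum is at most the average, and the average is the old value. -/
theorem estimator_update_bestDeadline_le (hW : (initialWindow dmax M T γ).Nonempty)
    {σ : Packet E → Option ℕ} {p : Packet E} (hσ : σ p = none) :
    estimator ε dmax M T γ S (Function.update σ p (some (bestDeadline ε dmax M T γ S σ p))) ≤
      estimator ε dmax M T γ S σ := by
  refine le_of_le_of_eq ?_ (expect_estimator_update (S := S) hW hσ)
  exact Finset.le_expect hW (bestDeadline_spec hW σ p).2

/-- The last clause lets the choice made for the head of the list survive the later updates. -/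
theorem foldl_bestDeadline_spec (hW : (initialWindow dmax M T γ).Nonempty)
    (l : List (Packet E)) (hl : l.Nodup) (σ : Packet E → Option ℕ) (hσ : ∀ p ∈ l, σ p = none) :
    let σ' := l.foldl
      (fun σ p => Function.update σ p (some (bestDeadline ε dmax M T γ S σ p))) σ
    estimator ε dmax M T γ S σ' ≤ estimator ε dmax M T γ S σ ∧
      (∀ p ∈ l, ∃ δ ∈ initialWindow dmax M T γ, σ' p = some δ) ∧ ∀ p ∉ l, σ' p = σ p := by
  induction l generalizing σ with
  | nil => simp
  | cons a l ih =>
    obtain ⟨ha, hl⟩ := List.nodup_cons.mp hl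
    obtain ⟨h1, h2, h3⟩ := ih hl
      (Function.update σ a (some (bestDeadline ε dmax M T γ S σ a))) fun p hp => by
        rw [Function.update_of_ne (ne_of_mem_of_not_mem hp ha)]
        exact hσ p (List.mem_cons_of_mem a hp)
    refine ⟨h1.trans (estimator_update_bestDeadline_le hW (hσ a List.mem_cons_self)), ?_, ?_⟩
    · intro p hp
      rcases List.mem_cons.mp hp with rfl | hp
      · refine ⟨_, (bestDeadline_spec (S := S) (ε := ε) hW σ p).1, ?_⟩
        exact (h3 p ha).trans (Function.update_self ..)
      · exact h2 p hp
    · intro p hp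
      rw [List.mem_cons, not_or] at hp
      exact (h3 p hp.2).trans (Function.update_of_ne hp.1 ..)

theorem condExpAssignment_spec (hW : (initialWindow dmax M T γ).Nonempty) :
    estimator ε dmax M T γ S (condExpAssignment ε dmax M T γ S) ≤
        estimator ε dmax M T γ S (fun _ => none) ∧
      ∀ p ∈ S, ∃ δ ∈ initialWindow dmax M T γ, condExpAssignment ε dmax M T γ S p = some δ := by
  obtain ⟨h1, h2, _⟩ := foldl_bestDeadline_spec (ε := ε) (S := S) hW (S.sort (· ≤ ·))
    (S.sort_nodup _) (fun _ => none) fun _ _ => rfl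
  exact ⟨h1, fun p hp => h2 p ((S.mem_sort _).mpr hp)⟩

/-- The initial deadlines chosen at one link put at most `(1 + ε/2) β T` deadlines for a link `e`
into any window of length `T`. -/
theorem sum_indicatorX_condExpAssignment_le [Nonempty E] {w : ℕ} (hε : 0 < ε) (hε1 : ε ≤ 1)
    (hw : 1 ≤ w) (hM : IsIntervalLength (Fintype.card E) w ε dmax M)
    (hS : ∀ p ∈ S, p.route.Nodup) (e : E) {t : ℕ}
    (ht : t ∈ Finset.Ico (γ * M) ((γ + 1) * M - spacing (Fintype.card E) ε M)) :
    ((∑ p ∈ S.filter (fun p => e ∈ p.route), indicatorX (spacing (Fintype.card E) ε M) p e t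
        ((condExpAssignment ε dmax M (spacing (Fintype.card E) ε M) γ S p).getD 0) : ℕ) : ℝ) ≤
      (1 + ε / 2) * beta (Fintype.card E) ε dmax M (spacing (Fintype.card E) ε M) S e *
        spacing (Fintype.card E) ε M := by
  set T := spacing (Fintype.card E) ε M
  set σ := condExpAssignment ε dmax M T γ S with hσ
  obtain ⟨h1, h2⟩ := condExpAssignment_spec (ε := ε) (S := S)
    (initialWindow_nonempty (γ := γ) (hM.mul_lt hε hε1 hw))
  have hlt := h1.trans_lt (estimator_none_lt_one hε hε1 hw hM hS)
  have hpos : (0 : ℝ) < 1 + ε / 2 := by linarith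
  have hterm0 : ∀ e : E, ∀ t, 0 ≤ (∏ p ∈ S.filter (fun p => e ∈ p.route),
      condMoment ε T (initialWindow dmax M T γ) p e t (σ p)) /
      (1 + ε / 2) ^ ((1 + ε / 2) * beta (Fintype.card E) ε dmax M T S e * T) := fun e t =>
    div_nonneg (Finset.prod_nonneg fun p _ => condMoment_nonneg hε.le _ _ _ _)
      (Real.rpow_nonneg hpos.le _)
  -- All terms are nonnegative and their sum is below one, so each single term is too.
  have hterm : (∏ p ∈ S.filter (fun p => e ∈ p.route),
      condMoment ε T (initialWindow dmax M T γ) p e t (σ p)) /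
      (1 + ε / 2) ^ ((1 + ε / 2) * beta (Fintype.card E) ε dmax M T S e * T) < 1 :=
    lt_of_le_of_lt ((Finset.single_le_sum (fun t _ => hterm0 e t) ht).trans
      (Finset.single_le_sum (fun e _ => Finset.sum_nonneg fun t _ => hterm0 e t)
        (Finset.mem_univ e))) hlt
  rw [div_lt_one (Real.rpow_pos_of_pos hpos _)] at hterm
  -- With every packet of `S` decided, no expectation remains: the product is a pure power, and
  -- exponents can be compared.
  have hprod : ∏ p ∈ S.filter (fun p => e ∈ p.route),
      condMoment ε T (initialWindow dmax M T γ) p e t (σ p) =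
      (1 + ε / 2) ^ ∑ p ∈ S.filter (fun p => e ∈ p.route), indicatorX T p e t ((σ p).getD 0) := by
    rw [← Finset.prod_pow_eq_pow_sum]
    refine Finset.prod_congr rfl fun p hp => ?_
    obtain ⟨δ, _, hδ⟩ := h2 p (Finset.mem_filter.mp hp).1
    rw [← hσ] at hδ
    rw [hδ]
    rfl
  rw [hprod, ← Real.rpow_natCast, Real.rpow_lt_rpow_left_iff (by linarith)] at hterm
  exact hterm.le

end Estimator

/-- The rates `β` of all initial links together stay below `1 - ε / 2`. -/
theorem sum_beta_le {E : Type*} [DecidableEq E] [Fintype E] [Nonempty E] {ε : ℝ} {dmax M w : ℕ}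
    (hε : 0 < ε) (hε1 : ε ≤ 1) (hw : 1 ≤ w)
    (hM : IsIntervalLength (Fintype.card E) w ε dmax M) (S : E → Finset (Packet E)) (e : E)
    (hS : ((∑ e₀, ((S e₀).filter (fun p => e ∈ p.route)).card : ℕ) : ℝ) ≤ (1 - ε) * M) :
    ∑ e₀, beta (Fintype.card E) ε dmax M (spacing (Fintype.card E) ε M) (S e₀) e ≤ 1 - ε / 2 := by
  set T := spacing (Fintype.card E) ε M
  have hM1 : (1 : ℝ) ≤ M := by exact_mod_cast hw.trans hM.2
  have hm : (0 : ℝ) < Fintype.card E := by exact_mod_cast Fintype.card_pos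
  have hlt : ((dmax : ℝ) + 1) * T < M := by exact_mod_cast hM.mul_lt hε hε1 hw
  have hD : 0 < (M : ℝ) - (dmax + 1) * T := by linarith
  have hle := hM.mul_le hε
  -- Bounding each maximum by a sum, the `m` floors `ε / (3m)` cost `ε / 3` in total; the remaining
  -- `ε / 6` pays for the factor `M / (M - (dmax + 1) T)`.
  have hmax : ∑ e₀, max ((((S e₀).filter (fun p => e ∈ p.route)).card : ℝ) / M)
      (ε / (3 * Fintype.card E)) ≤ 1 - 2 * ε / 3 := by
    calc _ ≤ ∑ e₀, ((((S e₀).filter (fun p => e ∈ p.route)).card : ℝ) / M +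
          ε / (3 * Fintype.card E)) :=
          Finset.sum_le_sum fun e₀ _ => max_le_add_of_nonneg (by positivity) (by positivity)
      _ = ((∑ e₀, ((S e₀).filter (fun p => e ∈ p.route)).card : ℕ) : ℝ) / M + ε / 3 := by
          rw [Finset.sum_add_distrib, ← Finset.sum_div, Finset.sum_const, Finset.card_univ,
            nsmul_eq_mul]
          push_cast
          congr 1
          field_simp
      _ ≤ (1 - ε) * M / M + ε / 3 := by gcongr
      _ = 1 - 2 * ε / 3 := by field_simp; ring
  unfold beta
  rw [← Finset.mul_sum]
  refine (mul_le_mul_of_nonneg_left hmax (by positivity)).trans ?_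
  rw [div_mul_eq_mul_div, div_le_iff₀ hD]
  nlinarith

/-! ### Earliest deadline first -/

namespace DistributedProtocol

theorem time_lt_batchIndex_mul {E : Type*} (P : DistributedProtocol E) (hP : 0 < P.interval)
    (p : Packet E) :
    p.time < P.batchIndex p * P.interval := by
  rw [batchIndex, mul_comm]
  exact Nat.lt_mul_div_succ _ hP

variable {V E : Type*} [DecidableEq E] [LinearOrder (Packet E)] (P : DistributedProtocol E)
  {G : Network V E} (A : Injection G)

theorem crossed_succ_of_serve {t : ℕ} {e : E} {p : Packet E}
    (h : P.serve e t (P.queue A (P.crossed A t) t e) = some (p, P.stamp A p)) :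
    P.crossed A (t + 1) p = P.crossed A t p + 1 := by
  rw [crossed]
  exact if_pos ⟨e, h⟩

theorem crossed_mono (p : Packet E) : Monotone fun t => P.crossed A t p := by
  refine monotone_nat_of_le_succ fun t => ?_
  simp only [crossed]
  split_ifs <;> omega

theorem mem_queue {c : Packet E → ℕ} {t : ℕ} {e : E} {x : Packet E × ℕ} :
    x ∈ P.queue A c t e ↔ x.1 ∈ A.pkts x.1.time ∧ x.1.time < t ∧
      P.batchIndex x.1 * P.interval ≤ t ∧ x.1.route[c x.1]? = some e ∧ x.2 = P.stamp A x.1 := by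
  obtain ⟨p, n⟩ := x
  simp only [queue, Finset.mem_image, Finset.mem_filter, Finset.mem_biUnion, Finset.mem_range,
    Prod.mk.injEq]
  constructor
  · rintro ⟨q, ⟨⟨s, hs, hq⟩, h1, h2⟩, rfl, rfl⟩
    obtain rfl := A.time_eq s q hq
    exact ⟨hq, hs, h1, h2, rfl⟩
  · rintro ⟨h1, h2, h3, h4, rfl⟩
    exact ⟨p, ⟨⟨_, h2, h1⟩, h3, h4⟩, rfl, rfl⟩

theorem crossed_le_length (t : ℕ) (p : Packet E) : P.crossed A t p ≤ p.route.length := by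
  induction t with
  | zero => exact Nat.zero_le _
  | succ t ih =>
    simp only [crossed]
    split_ifs with h
    · obtain ⟨e, he⟩ := h
      obtain ⟨-, -, -, h, -⟩ := (P.mem_queue A).mp (P.serve_mem _ _ _ _ he)
      exact (List.getElem?_eq_some_iff.mp h).1
    · exact ih

variable {P A}

/-- Under earliest deadline first, if packets are released at least `T` steps before their first
deadline and at most `T` deadlines for any link fall into any `T` consecutive steps, then all
deadlines are met. -/
theorem lt_crossed_of_load_le {T : ℕ} (hT : 0 < T) (hP : 0 < P.interval)
    (hserve : ∀ e t Q, P.serve e t Q = Q.toList.argmin (priority T e))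
    (hrelease : ∀ p ∈ A.pkts p.time, P.batchIndex p * P.interval + T ≤ P.stamp A p)
    (hload : ∀ (e : E) (τ : ℕ) (F : Finset (Packet E)), (∀ q ∈ F, q ∈ A.pkts q.time ∧
      e ∈ q.route ∧ τ < P.stamp A q + q.route.idxOf e * T + T ∧
      P.stamp A q + q.route.idxOf e * T ≤ τ) → F.card ≤ T)
    (τ : ℕ) {p : Packet E} (hp : p ∈ A.pkts p.time) {k : ℕ} (hk : k < p.route.length)
    (hτ : P.stamp A p + k * T = τ) : k < P.crossed A τ p := by
  classical
  induction τ using Nat.strong_induction_on generalizing p k with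
  | _ τ ih =>
  by_contra hlt
  rw [not_lt] at hlt
  have hrel := hrelease p hp
  -- The previous deadline, `τ - T`, was met by induction; at the first link the packet is already
  -- released by then.
  have harrive : k ≤ P.crossed A (τ - T) p := by
    cases k with
    | zero => exact Nat.zero_le _
    | succ j =>
      rw [add_one_mul] at hτ
      exact ih (τ - T) (by omega) hp (by omega) (by omega)
  have hcross : ∀ s, τ - T ≤ s → s ≤ τ → P.crossed A s p = k := fun s h1 h2 =>
    le_antisymm ((P.crossed_mono A p h2).trans hlt) (harrive.trans (P.crossed_mono A p h1))
  have hnodup : ∀ q ∈ A.pkts q.time, q.route.Nodup := fun q hq => (A.isRoute _ q hq).2.2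
  set e := p.route[k]
  have hidx : p.route.idxOf e = k := (hnodup p hp).idxOf_getElem k hk
  have hpT : T ≤ τ := by omega
  -- While `p` waits, `e` is never idle and serves only packets of no later deadline.
  have hstep : ∀ s, τ - T ≤ s → s < τ → ∃ q, P.crossed A (s + 1) q = P.crossed A s q + 1 ∧
      P.crossed A s q = q.route.idxOf e ∧ q ≠ p ∧ q ∈ A.pkts q.time ∧ e ∈ q.route ∧
      τ < P.stamp A q + q.route.idxOf e * T + T ∧ P.stamp A q + q.route.idxOf e * T ≤ τ := by
    intro s hs1 hs2
    have hmem : (p, P.stamp A p) ∈ P.queue A (P.crossed A s) s e := by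
      refine (P.mem_queue A).mpr ⟨hp, ?_, ?_, ?_, rfl⟩
      · dsimp only
        have := P.time_lt_batchIndex_mul hP p
        omega
      · dsimp only
        omega
      · dsimp only
        rw [hcross s hs1 hs2.le]
        exact List.getElem?_eq_getElem hk
    obtain ⟨x, hx⟩ : ∃ x, P.serve e s (P.queue A (P.crossed A s) s e) = some x := by
      rw [← Option.ne_none_iff_exists', hserve]
      intro h
      rw [List.argmin_eq_none, Finset.toList_eq_nil] at h
      rw [h] at hmem
      exact Finset.notMem_empty _ hmem
    obtain ⟨q, n⟩ := x
    obtain ⟨h1, -, -, h4, hn⟩ := (P.mem_queue A).mp (P.serve_mem _ _ _ _ hx)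
    dsimp only at h1 h4 hn
    subst hn
    have hinc := P.crossed_succ_of_serve A hx
    obtain ⟨hlen, hget⟩ := List.getElem?_eq_some_iff.mp h4
    have hq : P.crossed A s q = q.route.idxOf e := by
      rw [← hget, (hnodup q h1).idxOf_getElem]
    have hprio : P.stamp A q + q.route.idxOf e * T ≤ τ := by
      rw [hserve] at hx
      have h := not_lt.mp (List.not_lt_of_mem_argmin (Finset.mem_toList.mpr hmem) hx)
      have h := (Prod.Lex.toLex_le_toLex'.mp h).1
      dsimp only at h
      rwa [hidx, hτ] at h
    refine ⟨q, hinc, hq, ?_, h1, List.mem_of_getElem? h4, ?_, hprio⟩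
    · rintro rfl
      rw [hcross s hs1 hs2.le, hcross (s + 1) (by omega) hs2] at hinc
      omega
    -- A deadline at or before `τ - T` was met by induction, so such a `q` would have left `e`
    -- before step `s`.
    · by_contra hlate
      have h := ih (P.stamp A q + q.route.idxOf e * T) (by omega) h1 (hq ▸ hlen) rfl
      have := h.trans_le (P.crossed_mono A q
        (show P.stamp A q + q.route.idxOf e * T ≤ s by omega))
      dsimp only at this
      omega
  have : Nonempty (Packet E) := ⟨p⟩
  choose! f hf using hstep
  -- Once served at `e`, a packet has moved past the only position of `e` on its route.
  have hinj : Set.InjOn f (Finset.Ico (τ - T) τ) := by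
    have hlt : ∀ a ∈ Finset.Ico (τ - T) τ, ∀ b ∈ Finset.Ico (τ - T) τ, a < b → f a ≠ f b := by
      intro a ha b hb hab h
      rw [Finset.mem_Ico] at ha hb
      obtain ⟨ha1, ha2, -⟩ := hf a ha.1 ha.2
      obtain ⟨-, hb2, -⟩ := hf b hb.1 hb.2
      rw [← h] at hb2
      have := P.crossed_mono A (f a) (show a + 1 ≤ b from hab)
      dsimp only at this
      omega
    intro a ha b hb h
    rcases lt_trichotomy a b with hab | hab | hab
    · exact absurd h (hlt a ha b hb hab)
    · exact hab
    · exact absurd h.symm (hlt b hb a ha hab)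
  have hcard := hload e τ (insert p ((Finset.Ico (τ - T) τ).image f)) fun q hq => by
    rcases Finset.mem_insert.mp hq with hqp | hq
    · rw [hqp, hidx]
      exact ⟨hp, List.getElem_mem hk, by omega, by omega⟩
    · obtain ⟨s, hs, rfl⟩ := Finset.mem_image.mp hq
      rw [Finset.mem_Ico] at hs
      exact (hf s hs.1 hs.2).2.2.2
  rw [Finset.card_insert_of_notMem, Finset.card_image_of_injOn hinj, Nat.card_Ico] at hcard
  · omega
  · intro h
    obtain ⟨s, hs, hsp⟩ := Finset.mem_image.mp h
    rw [Finset.mem_Ico] at hs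
    exact (hf s hs.1 hs.2).2.2.1 hsp

end DistributedProtocol

theorem Injection.exists_head? {V E : Type*} {G : Network V E} (A : Injection G) {p : Packet E}
    (hp : p ∈ A.pkts p.time) : ∃ e₀, p.route.head? = some e₀ := by
  obtain ⟨e₀, l, h⟩ := List.exists_cons_of_ne_nil (A.isRoute _ p hp).1
  exact ⟨e₀, by rw [h]; rfl⟩

/-! ### Load and delivery for the derandomized protocol -/

section Derandomized

variable {V E : Type*} [DecidableEq E] [LinearOrder (Packet E)] {G : Network V E}

theorem Injection.mem_batch (A : Injection G) {M γ : ℕ} {e₀ : E} {p : Packet E} :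
    p ∈ A.batch M γ e₀ ↔ p ∈ A.pkts p.time ∧ (γ - 1) * M ≤ p.time ∧ p.time < γ * M ∧
      p.route.head? = some e₀ := by
  simp only [batch, Finset.mem_filter, Finset.mem_biUnion, Finset.mem_Ico]
  constructor
  · rintro ⟨⟨t, ⟨h1, h2⟩, hp⟩, h3⟩
    obtain rfl := A.time_eq t p hp
    exact ⟨hp, h1, h2, h3⟩
  · rintro ⟨hp, h1, h2, h3⟩
    exact ⟨⟨_, ⟨h1, h2⟩, hp⟩, h3⟩

/-- The batches of one interval at all initial links contain at most `r M` packets through `e`. -/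
theorem Injection.Admissible.sum_card_batch_le [Fintype E] {A : Injection G} {w M γ : ℕ} {r : ℝ}
    (hA : A.Admissible w r) (hM : w ≤ M) (hγ : 1 ≤ γ) (e : E) :
    ((∑ e₀, ((A.batch M γ e₀).filter (fun p => e ∈ p.route)).card : ℕ) : ℝ) ≤ r * M := by
  have hadm := hA ((γ - 1) * M) M hM e
  rw [← add_one_mul, Nat.sub_add_cancel hγ] at hadm
  refine le_trans ?_ hadm
  rw [← Nat.cast_sum, Nat.cast_le, ← Finset.card_biUnion]
  · refine le_trans (Finset.card_le_card fun p hp => ?_) Finset.card_biUnion_le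
    obtain ⟨e₀, -, hp⟩ := Finset.mem_biUnion.mp hp
    obtain ⟨hp, he⟩ := Finset.mem_filter.mp hp
    obtain ⟨hp, h1, h2, -⟩ := A.mem_batch.mp hp
    exact Finset.mem_biUnion.mpr ⟨p.time, Finset.mem_Ico.mpr ⟨h1, h2⟩,
      Finset.mem_filter.mpr ⟨hp, he⟩⟩
  -- A packet has only one initial link.
  · intro e₁ _ e₂ _ hne
    refine Finset.disjoint_left.mpr fun p h1 h2 => hne ?_
    have h1 := (A.mem_batch.mp (Finset.mem_filter.mp h1).1).2.2.2
    have h2 := (A.mem_batch.mp (Finset.mem_filter.mp h2).1).2.2.2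
    exact Option.some.inj (h1.symm.trans h2)

variable [Fintype E] {ε : ℝ} {w dmax M : ℕ} {A : Injection G}

theorem Injection.mem_batch_batchIndex (A : Injection G) (hM : 0 < M) {p : Packet E}
    (hp : p ∈ A.pkts p.time) {e₀ : E} (he₀ : p.route.head? = some e₀) :
    p ∈ A.batch M ((derandomized E ε dmax M).batchIndex p) e₀ := by
  refine A.mem_batch.mpr ⟨hp, ?_, (derandomized E ε dmax M).time_lt_batchIndex_mul hM p, he₀⟩
  exact Nat.div_mul_le_self _ _

theorem stamp_derandomized {p : Packet E} {e₀ : E} (he₀ : p.route.head? = some e₀) :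
    (derandomized E ε dmax M).stamp A p =
      (condExpAssignment ε dmax M (spacing (Fintype.card E) ε M)
        ((derandomized E ε dmax M).batchIndex p)
        (A.batch M ((derandomized E ε dmax M).batchIndex p) e₀) p).getD 0 := by
  rw [DistributedProtocol.stamp, he₀]
  rfl

theorem stamp_mem_initialWindow (hM : 0 < M)
    (hlt : (dmax + 1) * spacing (Fintype.card E) ε M < M) {p : Packet E}
    (hp : p ∈ A.pkts p.time) :
    (derandomized E ε dmax M).stamp A p ∈ initialWindow dmax M (spacing (Fintype.card E) ε M)
      ((derandomized E ε dmax M).batchIndex p) := by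
  obtain ⟨e₀, he₀⟩ := A.exists_head? hp
  -- Each packet belongs to its own batch, so the default 0 of `getD` never becomes its stamp.
  obtain ⟨δ, hδ, h⟩ := (condExpAssignment_spec (ε := ε) (initialWindow_nonempty hlt)).2 p
    (A.mem_batch_batchIndex (ε := ε) (dmax := dmax) hM hp he₀)
  rw [stamp_derandomized he₀, h]
  exact hδ

/-- All deadlines of a batch fall into the interval following it, away from its ends. -/
theorem deadline_bounds (hM : 0 < M)
    (hlt : (dmax + 1) * spacing (Fintype.card E) ε M < M) {p : Packet E}
    (hp : p ∈ A.pkts p.time) (hd : p.route.length ≤ dmax) {k : ℕ} (hk : k < p.route.length) :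
    (derandomized E ε dmax M).batchIndex p * M + spacing (Fintype.card E) ε M ≤
        (derandomized E ε dmax M).stamp A p + k * spacing (Fintype.card E) ε M ∧
      (derandomized E ε dmax M).stamp A p + k * spacing (Fintype.card E) ε M +
        spacing (Fintype.card E) ε M < ((derandomized E ε dmax M).batchIndex p + 1) * M := by
  have h := stamp_mem_initialWindow hM hlt hp
  rw [initialWindow, Finset.mem_Ico] at h
  have hkT := Nat.mul_le_mul_right (spacing (Fintype.card E) ε M) (show k + 1 ≤ dmax by omega)
  rw [add_one_mul] at hkT
  omega

/-- At most `T` packets have a deadline for the link `e` in a given window of length `T`. -/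
theorem card_deadlines_le (hε : 0 < ε) (hε1 : ε ≤ 1) (hw : 1 ≤ w)
    (hM : IsIntervalLength (Fintype.card E) w ε dmax M) (hA : A.Admissible w (1 - ε))
    (hd : ∀ p ∈ A.pkts p.time, p.route.length ≤ dmax) (e : E) (τ : ℕ) (F : Finset (Packet E))
    (hF : ∀ q ∈ F, q ∈ A.pkts q.time ∧ e ∈ q.route ∧
      τ < (derandomized E ε dmax M).stamp A q +
        q.route.idxOf e * spacing (Fintype.card E) ε M + spacing (Fintype.card E) ε M ∧
      (derandomized E ε dmax M).stamp A q +
        q.route.idxOf e * spacing (Fintype.card E) ε M ≤ τ) :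
    F.card ≤ spacing (Fintype.card E) ε M := by
  rcases F.eq_empty_or_nonempty with rfl | ⟨p, hpF⟩
  · exact Nat.zero_le _
  have : Nonempty E := ⟨e⟩
  set T := spacing (Fintype.card E) ε M
  set P := derandomized E ε dmax M with hP_def
  set γ := P.batchIndex p with hγ
  have hM0 : 0 < M := hw.trans hM.2
  have hT : 0 < T := spacing_pos Fintype.card_pos hε hM0
  have hlt := hM.mul_lt hε hε1 hw
  have hbd : ∀ q ∈ F, P.batchIndex q * M + T ≤ P.stamp A q + q.route.idxOf e * T ∧
      P.stamp A q + q.route.idxOf e * T + T < (P.batchIndex q + 1) * M := fun q hq =>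
    deadline_bounds hM0 hlt (hF q hq).1 (hd q (hF q hq).1)
      (List.idxOf_lt_length_iff.mpr (hF q hq).2.1)
  -- The margin `T` at both ends of an interval keeps deadlines of different batches more than `T`
  -- apart.
  have hsep : ∀ q ∈ F, ∀ q' ∈ F, ¬ P.batchIndex q < P.batchIndex q' := by
    intro q hq q' hq' h
    have h1 := hbd q hq
    have h2 := hbd q' hq'
    have h3 := Nat.mul_le_mul_right M (show P.batchIndex q + 1 ≤ P.batchIndex q' from h)
    have h4 := hF q hq
    have h5 := hF q' hq'
    omega
  have hbatch : ∀ q ∈ F, P.batchIndex q = γ := fun q hq =>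
    le_antisymm (not_lt.mp (hsep p hpF q hq)) (not_lt.mp (hsep q hq p hpF))
  -- The deadlines in question lie in `[τ + 1 - T, τ + 1)`, a window covered by the estimator.
  have ht : τ + 1 - T ∈ Finset.Ico (γ * M) ((γ + 1) * M - T) := by
    have h1 := hbd p hpF
    have h2 := hF p hpF
    rw [hbatch p hpF] at h1
    rw [Finset.mem_Ico]
    omega
  have hnodup : ∀ e₀, ∀ q ∈ A.batch M γ e₀, q.route.Nodup := fun e₀ q hq =>
    (A.isRoute _ q (A.mem_batch.mp hq).1).2.2
  have hcard : F.card ≤ ∑ e₀, ∑ q ∈ (A.batch M γ e₀).filter (fun q => e ∈ q.route),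
      indicatorX T q e (τ + 1 - T)
        ((condExpAssignment ε dmax M T γ (A.batch M γ e₀) q).getD 0) := by
    have hsub : F ⊆ Finset.univ.biUnion fun e₀ =>
        ((A.batch M γ e₀).filter (fun q => e ∈ q.route)).filter fun q =>
          indicatorX T q e (τ + 1 - T)
            ((condExpAssignment ε dmax M T γ (A.batch M γ e₀) q).getD 0) = 1 := by
      intro q hq
      obtain ⟨h1, h2, h3, h4⟩ := hF q hq
      obtain ⟨e₀, he₀⟩ := A.exists_head? h1
      have hmem := A.mem_batch_batchIndex (ε := ε) (dmax := dmax) hM0 h1 he₀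
      have hst := stamp_derandomized (A := A) (ε := ε) (dmax := dmax) (M := M) he₀
      rw [← hP_def, hbatch q hq] at hmem hst
      refine Finset.mem_biUnion.mpr ⟨e₀, Finset.mem_univ _, Finset.mem_filter.mpr
        ⟨Finset.mem_filter.mpr ⟨hmem, h2⟩, if_pos ⟨q.route.idxOf e, List.getElem?_idxOf h2, ?_⟩⟩⟩
      rw [← hst]
      omega
    refine (Finset.card_le_card hsub).trans (Finset.card_biUnion_le.trans ?_)
    refine Finset.sum_le_sum fun e₀ _ => ?_
    rw [Finset.card_filter]
    refine Finset.sum_le_sum fun q _ => ?_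
    split_ifs with h
    · exact h.ge
    · exact Nat.zero_le _
  have hβ := sum_beta_le hε hε1 hw hM (A.batch M γ) e
    (hA.sum_card_batch_le hM.2 (Nat.le_add_left 1 _) e)
  have hreal : (F.card : ℝ) ≤ T := by
    calc (F.card : ℝ) ≤ _ := Nat.cast_le.mpr hcard
      _ ≤ ∑ e₀, (1 + ε / 2) * beta (Fintype.card E) ε dmax M T (A.batch M γ e₀) e * T := by
          rw [Nat.cast_sum]
          exact Finset.sum_le_sum fun e₀ _ =>
            sum_indicatorX_condExpAssignment_le hε hε1 hw hM (hnodup e₀) e ht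
      _ ≤ (1 + ε / 2) * (1 - ε / 2) * T := by
          rw [← Finset.sum_mul, ← Finset.mul_sum]
          gcongr
      _ ≤ 1 * T := by
          gcongr
          nlinarith [sq_nonneg ε]
      _ = T := one_mul _
  exact_mod_cast hreal

theorem deliveredBy_derandomized (hε : 0 < ε) (hε1 : ε ≤ 1) (hw : 1 ≤ w)
    (hM : IsIntervalLength (Fintype.card E) w ε dmax M) (hA : A.Admissible w (1 - ε))
    (hd : ∀ p ∈ A.pkts p.time, p.route.length ≤ dmax) {p : Packet E} (hp : p ∈ A.pkts p.time) :
    (derandomized E ε dmax M).DeliveredBy A (p.time + 2 * M) p := by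
  obtain ⟨e, -⟩ := A.exists_head? hp
  have : Nonempty E := ⟨e⟩
  have hM0 : 0 < M := hw.trans hM.2
  have hlt := hM.mul_lt hε hε1 hw
  have hlen : 0 < p.route.length := List.length_pos_iff.mpr (A.isRoute _ p hp).1
  -- Meeting the deadline at the last link is delivery.
  have hk : p.route.length - 1 < p.route.length := Nat.sub_lt hlen one_pos
  have hbd := deadline_bounds hM0 hlt hp (hd p hp) hk
  have hcross := DistributedProtocol.lt_crossed_of_load_le (P := derandomized E ε dmax M) (A := A)
    (spacing_pos Fintype.card_pos hε hM0) hM0 (fun _ _ _ => rfl)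
    (fun q hq => (Finset.mem_Ico.mp (stamp_mem_initialWindow hM0 hlt hq)).1)
    (card_deadlines_le hε hε1 hw hM hA hd) _ hp hk rfl
  refine le_antisymm (DistributedProtocol.crossed_le_length ..) ?_
  have hend : ((derandomized E ε dmax M).batchIndex p + 1) * M ≤ p.time + 2 * M := by
    have : (derandomized E ε dmax M).batchIndex p * M ≤ p.time + M := by
      rw [DistributedProtocol.batchIndex, add_one_mul]
      exact Nat.add_le_add_right (Nat.div_mul_le_self _ _) _
    rw [add_one_mul]
    omega
  refine le_trans ?_ ((derandomized E ε dmax M).crossed_mono A p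
    (show (derandomized E ε dmax M).stamp A p +
      (p.route.length - 1) * spacing (Fintype.card E) ε M ≤ p.time + 2 * M by omega))
  dsimp only
  omega

end Derandomized

/-! ### A valid interval length of polynomial size -/

/-- There is an interval length bounded polynomially in `m`, `w` and `1 / ε`. -/
theorem exists_isIntervalLength_le {m w dmax : ℕ} {ε : ℝ} (hε : 0 < ε)
    (hw : 1 ≤ w) (hd : dmax ≤ m) :
    ∃ M : ℕ, IsIntervalLength m w ε dmax M ∧
      (M : ℝ) ≤ (6 * (m + 1) * (1 / ε) * (144 * m ^ 2 * (1 / ε) ^ 3 + 1) + w + 1) ^ 2 := by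
  set C : ℝ := 6 * (m + 1) * (1 / ε) with hC
  set B : ℝ := 144 * m ^ 2 * (1 / ε) ^ 3 + 1 with hB
  set N : ℕ := ⌈C * B + w⌉₊ with hN
  have hC0 : 0 ≤ C := by positivity
  have hB0 : 0 ≤ B := by positivity
  have hN1 : C * B + w ≤ N := Nat.le_ceil _
  have hN2 : (N : ℝ) < C * B + w + 1 := Nat.ceil_lt_add_one (by positivity)
  have hw1 : (1 : ℝ) ≤ w := by exact_mod_cast hw
  have hwN : (w : ℝ) ≤ N := by nlinarith [mul_nonneg hC0 hB0]
  have hN3 : (1 : ℝ) ≤ N := hw1.trans hwN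
  -- For `M = N²` the logarithm is at most linear in `N`, so `T ≤ B N`, where the `+ 1` in `B`
  -- absorbs the rounding. Since `C` bounds the coefficient of `T`, the requirement follows from `C
  -- B ≤ N`.
  refine ⟨N ^ 2, ⟨?_, ?_⟩, ?_⟩
  · have hlog : Real.log (2 * (N ^ 2 : ℕ) * m ^ 2) ≤ 4 * N * m := by
      rcases Nat.eq_zero_or_pos m with rfl | hm
      · simp
      have hm1 : (0 : ℝ) < m := by exact_mod_cast hm
      calc Real.log (2 * (N ^ 2 : ℕ) * m ^ 2) ≤ Real.log ((2 * N * m) ^ 2) := by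
            apply Real.log_le_log
            · push_cast
              positivity
            · push_cast
              nlinarith [sq_nonneg ((N : ℝ) * m)]
        _ = 2 * Real.log (2 * N * m) := by rw [Real.log_pow]; norm_num
        _ ≤ 2 * (2 * N * m) := by
            gcongr
            exact Real.log_le_self (by positivity)
        _ = 4 * N * m := by ring
    have hnonneg : 0 ≤ Real.log (2 * (N ^ 2 : ℕ) * m ^ 2) := by
      rw [show (2 * ((N ^ 2 : ℕ) : ℝ) * m ^ 2) = ((2 * N ^ 2 * m ^ 2 : ℕ) : ℝ) by push_cast; ring]
      exact Real.log_natCast_nonneg _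
    have hT : (spacing m ε (N ^ 2) : ℝ) ≤ B * N := by
      calc (spacing m ε (N ^ 2) : ℝ)
          ≤ 36 * m / ε ^ 3 * Real.log (2 * (N ^ 2 : ℕ) * m ^ 2) + 1 :=
            (Nat.ceil_lt_add_one (by positivity)).le
        _ ≤ 36 * m / ε ^ 3 * (4 * N * m) + 1 * N := by gcongr; linarith
        _ = B * N := by rw [hB]; field_simp; ring
    have hd' : (dmax : ℝ) ≤ m := by exact_mod_cast hd
    have hcoef : (1 - ε / 2) / (ε / 6) * (dmax + 1) ≤ C := by
      calc (1 - ε / 2) / (ε / 6) * ((dmax : ℝ) + 1) ≤ 1 / (ε / 6) * (m + 1) := by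
            gcongr
            linarith
        _ = C := by rw [hC]; field_simp
    calc (1 - ε / 2) / (ε / 6) * ((dmax : ℝ) + 1) * spacing m ε (N ^ 2) ≤ C * (B * N) := by
          gcongr
      _ = C * B * N := by ring
      _ ≤ N * N := by
          gcongr
          linarith
      _ = ((N ^ 2 : ℕ) : ℝ) := by push_cast; ring
  · have : w ≤ N := by exact_mod_cast hwN
    nlinarith
  · push_cast
    gcongr

end PacketScheduling

theorem theorem2 :
    ∃ poly : MvPolynomial (Fin 3) ℝ,
      ∀ (V E : Type*) [Fintype E] [DecidableEq E] [LinearOrder (Packet E)]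
        (G : Network V E) (w dmax : ℕ) (r ε : ℝ),
        1 ≤ w → 0 ≤ r → r < 1 → ε = 1 - r → dmax ≤ Fintype.card E →
        (∃ M : ℕ, IsIntervalLength (Fintype.card E) w ε dmax M ∧
          2 * (M : ℝ) ≤ MvPolynomial.eval ![(Fintype.card E : ℝ), (w : ℝ), 1 / ε] poly) ∧
        ∀ M : ℕ, IsIntervalLength (Fintype.card E) w ε dmax M →
          ∀ A : Injection G, A.Admissible w r →
            (∀ t, ∀ p ∈ A.pkts t, p.route.length ≤ dmax) →
            ∀ s, ∀ p ∈ A.pkts s,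
              (derandomized E ε dmax M).DeliveredBy A (s + 2 * M) p := by
  -- Twice the bound of `exists_isIntervalLength_le`, with `m`, `w`, `1 / ε` as variables 0, 1, 2.
  refine ⟨2 * (6 * (.X 0 + 1) * .X 2 * (144 * .X 0 ^ 2 * .X 2 ^ 3 + 1) + .X 1 + 1) ^ 2, ?_⟩
  intro V E _ _ _ G w dmax r ε hw hr0 hr1 hε hd
  have hε0 : 0 < ε := by linarith
  have hε1 : ε ≤ 1 := by linarith
  obtain rfl : r = 1 - ε := by linarith
  refine ⟨?_, fun M hM A hA hdmax s p hp => ?_⟩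
  · obtain ⟨M, hM, hle⟩ := exists_isIntervalLength_le hε0 hw hd
    refine ⟨M, hM, (mul_le_mul_of_nonneg_left hle zero_le_two).trans_eq ?_⟩
    simp
  · obtain rfl := A.time_eq s p hp
    exact deliveredBy_derandomized hε0 hε1 hw hM hA (fun q hq => hdmax _ q hq) hp
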